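/- Let $n\ge 1$ and $m\ge 1$ be integers. For a matrix $A\in\mathbb M_n(\mathbb C)$ let $\|A\|$ be its operator norm with respect to the Euclidean norm on $\mathbb C^n$, let $A\circ B$ denote the entrywise product of matrices, and define the Schur norm $$\|M\|_{\mathrm S}=\max\{\|M\circ C\| : C\in\mathbb M_n(\mathbb C),\ \|C\|=1\}\qquad (M\in\mathbb M_n(\mathbb C)).$$ Let $$r_n=\max\{\|M\|_{\mathrm S} : M\in\mathbb M_n(\mathbb R),\ |m_{i,j}|\le 1\text{ for all } i,j\},$$ and let the $n$-th Schur spectrum be $$\sigma_n=\{\|M\|_{\mathrm S} : M\in\mathbb M_n(\mathbb R),\ m_{i,j}\in\{-1,1\}\text{ for all } i,j\}.$$ Then: 1. $r_n=\max\sigma_n$; 2. $\sigma_n\subseteq\sigma_{n+1}$; 3. $\sigma_n\sigma_m\subseteq\sigma_{nm}$, where $\sigma_n\sigma_m=\{xy : x\in\sigma_n,\ y\in\sigma_m\}$. -/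

import Mathlib

open scoped Matrix Pointwise Matrix.Norms.L2Operator

/-- The Schur norm of a complex square matrix `M`: the largest operator norm (with respect to the
Euclidean norm) of an entrywise product `M ⊙ C`, where `C` runs over the complex matrices of
operator norm `1`. The supremum is attained, see `schurNorm_isGreatest`. -/
noncomputable def schurNorm {ι : Type*} [Fintype ι] [DecidableEq ι] (M : Matrix ι ι ℂ) : ℝ :=
  sSup {x : ℝ | ∃ C : Matrix ι ι ℂ, ‖C‖ = 1 ∧ x = ‖M ⊙ C‖}

/-- The Schur norm of a real matrix, regarded as a complex matrix. -/
noncomputable def realSchurNorm {ι : Type*} [Fintype ι] [DecidableEq ι] (M : Matrix ι ι ℝ) : ℝ :=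
  schurNorm (M.map (fun x : ℝ => (x : ℂ)))

/-- Real `n × n` matrices with all entries of modulus at most `1`. -/
def boundedMatrices (n : ℕ) : Set (Matrix (Fin n) (Fin n) ℝ) :=
  {M | ∀ i j, |M i j| ≤ 1}

/-- Real `n × n` matrices with all entries equal to `1` or `-1`. -/
def signMatrices (n : ℕ) : Set (Matrix (Fin n) (Fin n) ℝ) :=
  {M | ∀ i j, M i j = -1 ∨ M i j = 1}

/-- The largest Schur norm of a real `n × n` matrix with entries of modulus at most `1`.
The supremum is attained for `1 ≤ n`, see `maxSchurNorm_isGreatest`. -/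
noncomputable def maxSchurNorm (n : ℕ) : ℝ :=
  sSup {x : ℝ | ∃ M ∈ boundedMatrices n, x = realSchurNorm M}

/-- The `n`-th Schur spectrum: the set of Schur norms of the `n × n` matrices with entries `±1`. -/
def schurSpectrum (n : ℕ) : Set ℝ :=
  {x : ℝ | ∃ M ∈ signMatrices n, x = realSchurNorm M}

theorem isCompact_setOf_norm_eq_one {ι : Type*} [Fintype ι] [DecidableEq ι] :
    IsCompact {C : Matrix ι ι ℂ | ‖C‖ = 1} := by
  have : ProperSpace (Matrix ι ι ℂ) := FiniteDimensional.proper ℂ _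
  have h : {C : Matrix ι ι ℂ | ‖C‖ = 1} = Metric.sphere 0 1 := by ext; simp
  rw [h]
  exact isCompact_sphere 0 1

theorem continuous_norm_hadamard {X ι : Type*} [TopologicalSpace X] [Fintype ι] [DecidableEq ι]
    {f g : X → Matrix ι ι ℂ} (hf : ∀ i j, Continuous fun x => f x i j)
    (hg : ∀ i j, Continuous fun x => g x i j) : Continuous fun x => ‖f x ⊙ g x‖ := by
  have h : Continuous fun x => f x ⊙ g x :=
    continuous_matrix fun i j => (hf i j).mul (hg i j)
  exact continuous_norm.comp h

/-- The maximum that defines the Schur norm exists. -/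
theorem schurNorm_isGreatest {ι : Type*} [Fintype ι] [DecidableEq ι] [Nonempty ι]
    (M : Matrix ι ι ℂ) :
    IsGreatest {x : ℝ | ∃ C : Matrix ι ι ℂ, ‖C‖ = 1 ∧ x = ‖M ⊙ C‖} (schurNorm M) := by
  have hf : Continuous fun C : Matrix ι ι ℂ => ‖M ⊙ C‖ :=
    continuous_norm_hadamard (fun _ _ => continuous_const)
      (fun i j => continuous_id.matrix_elem i j)
  obtain ⟨C, hC, hmax⟩ := isCompact_setOf_norm_eq_one.exists_isMaxOn
    ⟨(1 : Matrix ι ι ℂ), by simp⟩ hf.continuousOn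
  have h : IsGreatest {x : ℝ | ∃ C : Matrix ι ι ℂ, ‖C‖ = 1 ∧ x = ‖M ⊙ C‖} ‖M ⊙ C‖ :=
    ⟨⟨C, hC, rfl⟩, by rintro x ⟨D, hD, rfl⟩; exact hmax hD⟩
  rw [schurNorm, h.csSup_eq]
  exact h

theorem isCompact_boundedMatrices (n : ℕ) : IsCompact (boundedMatrices n) := by
  have h : boundedMatrices n =
      Set.pi Set.univ fun _ => Set.pi Set.univ fun _ => Set.Icc (-1 : ℝ) 1 := by
    ext M
    constructor
    · intro hM i _ j _
      exact abs_le.1 (hM i j)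
    · intro hM i j
      exact abs_le.2 (hM i trivial j trivial)
  rw [h]
  exact isCompact_univ_pi fun _ => isCompact_univ_pi fun _ => isCompact_Icc

/-- The maximum that defines `maxSchurNorm` exists. -/
theorem maxSchurNorm_isGreatest (n : ℕ) (hn : 1 ≤ n) :
    IsGreatest {x : ℝ | ∃ M ∈ boundedMatrices n, x = realSchurNorm M} (maxSchurNorm n) := by
  have : Nonempty (Fin n) := ⟨⟨0, hn⟩⟩
  have hc : Continuous fun p : Matrix (Fin n) (Fin n) ℝ × Matrix (Fin n) (Fin n) ℂ =>
      ‖(p.1.map (fun x : ℝ => (x : ℂ))) ⊙ p.2‖ :=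
    continuous_norm_hadamard
      (fun i j => Complex.continuous_ofReal.comp (continuous_fst.matrix_elem i j))
      (fun i j => continuous_snd.matrix_elem i j)
  obtain ⟨⟨M, C⟩, ⟨hM, hC⟩, hmax⟩ :=
    ((isCompact_boundedMatrices n).prod
      (isCompact_setOf_norm_eq_one (ι := Fin n))).exists_isMaxOn
      ⟨(0, 1), by simp [boundedMatrices]⟩ hc.continuousOn
  have h : IsGreatest {x : ℝ | ∃ M ∈ boundedMatrices n, x = realSchurNorm M}
      (realSchurNorm M) := by
    refine ⟨⟨M, hM, rfl⟩, ?_⟩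
    rintro x ⟨N, hN, rfl⟩
    obtain ⟨D, hD, hND⟩ := (schurNorm_isGreatest (N.map (fun x : ℝ => (x : ℂ)))).1
    have h1 := hmax (show (N, D) ∈ boundedMatrices n ×ˢ _ from ⟨hN, hD⟩)
    have h2 := (schurNorm_isGreatest (M.map (fun x : ℝ => (x : ℂ)))).2 ⟨C, hC, rfl⟩
    unfold realSchurNorm
    rw [hND]
    exact le_trans h1 h2
  rw [maxSchurNorm, h.csSup_eq]
  exact h

/-! For fixed `C`, the norm of `M ⊙ C` is convex in `M`, and the bounded matrices form the convex
hull of the sign matrices, so some sign matrix attains the maximum. The other two claims rest on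
`schurNorm_submatrix_le`: repeating or dropping rows and columns never increases the Schur norm.
Hence repeating them leaves it unchanged, and a sign matrix can be enlarged freely. Moreover `M ⊗ₖ
N` is the Hadamard product of two matrices with repeated rows and columns, so its Schur norm is at
most the product; test matrices `C ⊗ₖ D` give equality. -/

open scoped Kronecker

section OperatorNorm

variable {ι κ : Type*} [Fintype ι] [Fintype κ] [DecidableEq κ]

theorem norm_toLp_mulVec_le (A : Matrix ι κ ℂ) (x : κ → ℂ) :
    ‖WithLp.toLp 2 (A *ᵥ x)‖ ≤ ‖A‖ * ‖WithLp.toLp 2 x‖ :=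
  A.l2_opNorm_mulVec (WithLp.toLp 2 x)

theorem l2_opNorm_le_of_forall_mulVec (A : Matrix ι κ ℂ) {c : ℝ} (hc : 0 ≤ c)
    (h : ∀ x : κ → ℂ, ‖WithLp.toLp 2 (A *ᵥ x)‖ ≤ c * ‖WithLp.toLp 2 x‖) : ‖A‖ ≤ c :=
  ContinuousLinearMap.opNorm_le_bound _ hc fun x => h x.ofLp

/-- The factor `a` allows the supremum over one tensor factor to be taken while the other is held
fixed. -/
theorem mul_l2_opNorm_le_of_forall_mulVec (A : Matrix ι κ ℂ) {a c : ℝ} (ha : 0 ≤ a) (hc : 0 ≤ c)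
    (h : ∀ x : κ → ℂ, a * ‖WithLp.toLp 2 (A *ᵥ x)‖ ≤ c * ‖WithLp.toLp 2 x‖) :
    a * ‖A‖ ≤ c := by
  have : ‖(a : ℂ) • A‖ ≤ c := by
    refine l2_opNorm_le_of_forall_mulVec _ hc fun x => ?_
    rw [Matrix.smul_mulVec, WithLp.toLp_smul, norm_smul, Complex.norm_real, Real.norm_of_nonneg ha]
    exact h x
  rwa [norm_smul, Complex.norm_real, Real.norm_of_nonneg ha] at this

end OperatorNorm

section Kronecker

variable {ι κ : Type*} [Fintype ι] [Fintype κ]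

theorem norm_toLp_mul_prod (x : ι → ℂ) (y : κ → ℂ) :
    ‖WithLp.toLp 2 (fun p : ι × κ => x p.1 * y p.2)‖ =
      ‖WithLp.toLp 2 x‖ * ‖WithLp.toLp 2 y‖ := by
  rw [EuclideanSpace.norm_eq, EuclideanSpace.norm_eq, EuclideanSpace.norm_eq,
    ← Real.sqrt_mul (by positivity), Finset.sum_mul_sum, Fintype.sum_prod_type]
  simp [mul_pow]

theorem kronecker_mulVec_mul_prod (A : Matrix ι ι ℂ) (B : Matrix κ κ ℂ) (x : ι → ℂ) (y : κ → ℂ) :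
    (A ⊗ₖ B) *ᵥ (fun p : ι × κ => x p.1 * y p.2) =
      fun p : ι × κ => (A *ᵥ x) p.1 * (B *ᵥ y) p.2 := by
  ext ⟨i, j⟩
  simp only [Matrix.mulVec, dotProduct, Matrix.kroneckerMap_apply, Finset.sum_mul_sum,
    Fintype.sum_prod_type]
  exact Finset.sum_congr rfl fun _ _ => Finset.sum_congr rfl fun _ _ => by ring

variable [DecidableEq ι] [DecidableEq κ]

/-- Tensoring with the identity is a star homomorphism of C⋆-algebras, hence contractive. -/
theorem l2_opNorm_kronecker_one_le (A : Matrix ι ι ℂ) :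
    ‖A ⊗ₖ (1 : Matrix κ κ ℂ)‖ ≤ ‖A‖ := by
  let φ : Matrix ι ι ℂ →⋆ₙₐ[ℂ] Matrix (ι × κ) (ι × κ) ℂ :=
    { toFun := fun A => A ⊗ₖ (1 : Matrix κ κ ℂ)
      map_smul' := fun c A => Matrix.smul_kronecker c A 1
      map_zero' := Matrix.zero_kronecker 1
      map_add' := fun A B => Matrix.add_kronecker A B 1
      map_mul' := fun A B => by rw [← Matrix.mul_kronecker_mul, Matrix.mul_one]
      map_star' := fun A => by
        simp [Matrix.star_eq_conjTranspose, Matrix.conjTranspose_kronecker] }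
  exact NonUnitalStarAlgHom.norm_apply_le φ A

theorem l2_opNorm_one_kronecker_le (B : Matrix κ κ ℂ) :
    ‖(1 : Matrix ι ι ℂ) ⊗ₖ B‖ ≤ ‖B‖ := by
  let φ : Matrix κ κ ℂ →⋆ₙₐ[ℂ] Matrix (ι × κ) (ι × κ) ℂ :=
    { toFun := fun B => (1 : Matrix ι ι ℂ) ⊗ₖ B
      map_smul' := fun c B => Matrix.kronecker_smul c 1 B
      map_zero' := Matrix.kronecker_zero 1
      map_add' := fun A B => Matrix.kronecker_add 1 A B
      map_mul' := fun A B => by rw [← Matrix.mul_kronecker_mul, Matrix.mul_one]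
      map_star' := fun A => by
        simp [Matrix.star_eq_conjTranspose, Matrix.conjTranspose_kronecker] }
  exact NonUnitalStarAlgHom.norm_apply_le φ B

theorem l2_opNorm_kronecker (A : Matrix ι ι ℂ) (B : Matrix κ κ ℂ) :
    ‖A ⊗ₖ B‖ = ‖A‖ * ‖B‖ := by
  apply le_antisymm
  · calc ‖A ⊗ₖ B‖ = ‖(A ⊗ₖ (1 : Matrix κ κ ℂ)) * ((1 : Matrix ι ι ℂ) ⊗ₖ B)‖ := by
          rw [← Matrix.mul_kronecker_mul, Matrix.mul_one, Matrix.one_mul]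
      _ ≤ ‖A ⊗ₖ (1 : Matrix κ κ ℂ)‖ * ‖(1 : Matrix ι ι ℂ) ⊗ₖ B‖ := norm_mul_le _ _
      _ ≤ ‖A‖ * ‖B‖ := by
          gcongr
          · exact l2_opNorm_kronecker_one_le A
          · exact l2_opNorm_one_kronecker_le B
  · refine mul_l2_opNorm_le_of_forall_mulVec B (norm_nonneg _) (norm_nonneg _) fun y => ?_
    rw [mul_comm ‖A‖]
    refine mul_l2_opNorm_le_of_forall_mulVec A (norm_nonneg _) (by positivity) fun x => ?_
    have h := norm_toLp_mulVec_le (A ⊗ₖ B) (fun p : ι × κ => x p.1 * y p.2)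
    rw [kronecker_mulVec_mul_prod, norm_toLp_mul_prod, norm_toLp_mul_prod] at h
    linarith

end Kronecker

section SchurNorm

/-- A vector on `κ` is the image, under a partial isometry supported on the graph of
`f : κ → ι`, of a vector on `ι`. -/
theorem exists_contraction_supported_on_graph {ι κ : Type*} [Fintype ι] [DecidableEq ι]
    [Fintype κ] (f : κ → ι) (z : κ → ℂ) :
    ∃ (U : Matrix κ ι ℂ) (w : ι → ℂ), (∀ k i, f k ≠ i → U k i = 0) ∧ ‖U‖ ≤ 1 ∧
      U *ᵥ w = z ∧ Uᴴ *ᵥ z = w := by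
  set s : ι → ℝ := fun i => ∑ k, if f k = i then ‖z k‖ ^ 2 else 0 with hs
  have hs0 : ∀ i, 0 ≤ s i := fun i => Finset.sum_nonneg fun k _ => by positivity
  have hz : ∀ k, s (f k) = 0 → z k = 0 := by
    intro k hk
    have := (Finset.sum_eq_zero_iff_of_nonneg (fun k _ => by positivity)).1 hk k (Finset.mem_univ k)
    simpa using this
  have hsq : ∀ i, ((√(s i) : ℝ) : ℂ) * (√(s i) : ℝ) = (s i : ℝ) := fun i => by
    rw [← Complex.ofReal_mul, Real.mul_self_sqrt (hs0 i)]
  have hsum : ∀ i, ∑ k, (if f k = i then (starRingEnd ℂ) (z k) * z k else 0) = (s i : ℂ) := by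
    intro i
    rw [hs, Complex.ofReal_sum]
    refine Finset.sum_congr rfl fun k _ => ?_
    split_ifs
    · rw [Complex.conj_mul']; push_cast; rfl
    · simp
  -- Column `i` is `z` restricted to the fibre over `i` and normalized. Where `z` vanishes on the
  -- fibre, division by zero makes the column zero.
  obtain ⟨U, hUapp⟩ : ∃ U : Matrix κ ι ℂ,
      ∀ k i, U k i = if f k = i then z k / ((√(s i) : ℝ) : ℂ) else 0 := ⟨fun _ _ => _, fun _ _ => rfl⟩
  refine ⟨U, fun i => (√(s i) : ℝ), fun k i h => by rw [hUapp, if_neg h], ?_, ?_, ?_⟩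
  · have hU : Uᴴ * U = Matrix.diagonal fun i => (s i : ℂ) / (s i : ℂ) := by
      ext i j
      rw [Matrix.mul_apply, Matrix.diagonal_apply]
      split_ifs with hij
      · subst hij
        nth_rw 1 [← hsum i]
        rw [Finset.sum_div]
        refine Finset.sum_congr rfl fun k _ => ?_
        by_cases hk : f k = i
        · simp [hUapp, hk, div_mul_div_comm, ← hsq i]
        · simp [hUapp, hk]
      · refine Finset.sum_eq_zero fun k _ => ?_
        by_cases hk : f k = i
        · have : f k ≠ j := fun h => hij (hk.symm.trans h)
          simp [hUapp, this]
        · simp [hUapp, hk]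
    have hle : ‖Uᴴ * U‖ ≤ 1 := by
      rw [hU, Matrix.l2_opNorm_diagonal]
      refine (pi_norm_le_iff_of_nonneg zero_le_one).2 fun i => ?_
      by_cases h : s i = 0 <;> simp [h]
    rw [Matrix.l2_opNorm_conjTranspose_mul_self] at hle
    exact abs_le_one_iff_mul_self_le_one.2 hle |> (le_abs_self _).trans
  · ext k
    simp only [Matrix.mulVec, dotProduct, hUapp, ite_mul, zero_mul, Finset.sum_ite_eq,
      Finset.mem_univ, if_true]
    by_cases h : s (f k) = 0
    · simp [h, hz k h]
    · refine div_mul_cancel₀ _ ?_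
      simpa [Real.sqrt_eq_zero (hs0 _)] using h
  · ext i
    simp only [Matrix.mulVec, dotProduct, Matrix.conjTranspose_apply]
    have : ∀ k, star (U k i) * z k =
        (if f k = i then (starRingEnd ℂ) (z k) * z k else 0) / (√(s i) : ℝ) := by
      intro k
      by_cases hk : f k = i
      · simp [hUapp, hk, div_mul_eq_mul_div]
      · simp [hUapp, hk]
    rw [Finset.sum_congr rfl fun k _ => this k, ← Finset.sum_div, hsum, ← hsq i]
    exact mul_self_div_self _

/-- Only `k` over `i` and `l` over `j` contribute to entry `(i, j)`, and there `M (f k) (g l) = M i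
j`. -/
theorem hadamard_conjTranspose_mul_mul {ι κ : Type*} [Fintype κ]
    {f g : κ → ι} {U V : Matrix κ ι ℂ}
    (hU : ∀ k i, f k ≠ i → U k i = 0) (hV : ∀ k i, g k ≠ i → V k i = 0)
    (M : Matrix ι ι ℂ) (C : Matrix κ κ ℂ) :
    M ⊙ (Uᴴ * C * V) = Uᴴ * (M.submatrix f g ⊙ C) * V := by
  ext i j
  simp only [Matrix.hadamard_apply, Matrix.mul_apply, Matrix.conjTranspose_apply,
    Matrix.submatrix_apply, Finset.sum_mul, Finset.mul_sum]
  refine Finset.sum_congr rfl fun l _ => Finset.sum_congr rfl fun k _ => ?_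
  by_cases hk : f k = i
  · by_cases hl : g l = j
    · rw [hk, hl]; ring
    · simp [hV l j hl]
  · simp [hU k i hk]

variable {ι κ : Type*} [Fintype ι] [DecidableEq ι] [Fintype κ] [DecidableEq κ]

theorem norm_hadamard_le_schurNorm_mul [Nonempty ι] (M C : Matrix ι ι ℂ) :
    ‖M ⊙ C‖ ≤ schurNorm M * ‖C‖ := by
  rcases eq_or_ne C 0 with rfl | hC
  · simp
  have hC' : 0 < ‖C‖ := norm_pos_iff.2 hC
  have h := (schurNorm_isGreatest M).2
    ⟨((‖C‖⁻¹ : ℝ) : ℂ) • C, by simp [norm_smul, hC'.ne'], rfl⟩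
  rw [Matrix.hadamard_smul, norm_smul, Complex.norm_real, Real.norm_of_nonneg (by positivity),
    inv_mul_le_iff₀ hC'] at h
  linarith

theorem schurNorm_nonneg (M : Matrix ι ι ℂ) : 0 ≤ schurNorm M :=
  Real.sSup_nonneg (by rintro x ⟨C, -, rfl⟩; exact norm_nonneg _)

theorem schurNorm_le [Nonempty ι] {M : Matrix ι ι ℂ} {c : ℝ}
    (h : ∀ C : Matrix ι ι ℂ, ‖C‖ = 1 → ‖M ⊙ C‖ ≤ c) : schurNorm M ≤ c := by
  obtain ⟨C, hC, hM⟩ := (schurNorm_isGreatest M).1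
  exact hM ▸ h C hC

theorem schurNorm_hadamard_le [Nonempty ι] (M N : Matrix ι ι ℂ) :
    schurNorm (M ⊙ N) ≤ schurNorm M * schurNorm N := by
  refine schurNorm_le fun C hC => ?_
  rw [Matrix.hadamard_assoc]
  refine (norm_hadamard_le_schurNorm_mul M _).trans ?_
  have := norm_hadamard_le_schurNorm_mul N C
  rw [hC, mul_one] at this
  exact mul_le_mul_of_nonneg_left this (schurNorm_nonneg M)

theorem schurNorm_submatrix_le [Nonempty κ] (M : Matrix ι ι ℂ) (f g : κ → ι) :
    schurNorm (M.submatrix f g) ≤ schurNorm M := by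
  have : Nonempty ι := ⟨f (Classical.arbitrary κ)⟩
  refine schurNorm_le fun C hC => l2_opNorm_le_of_forall_mulVec _ (schurNorm_nonneg M) fun x => ?_
  set y := (M.submatrix f g ⊙ C) *ᵥ x with hy
  obtain ⟨V, v, hV, hV1, hVv, hVx⟩ := exists_contraction_supported_on_graph g x
  obtain ⟨U, u, hU, hU1, hUu, hUy⟩ := exists_contraction_supported_on_graph f y
  -- The action of the submatrix on `x` is thus transported to `M`, tested against the contraction
  -- `Uᴴ * C * V`.
  have hu : u = (M ⊙ (Uᴴ * C * V)) *ᵥ v := by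
    rw [hadamard_conjTranspose_mul_mul hU hV, ← Matrix.mulVec_mulVec, hVv,
      ← Matrix.mulVec_mulVec, ← hy, hUy]
  have hVH : ‖Vᴴ‖ ≤ 1 := by rwa [Matrix.l2_opNorm_conjTranspose]
  have hUH : ‖Uᴴ‖ ≤ 1 := by rwa [Matrix.l2_opNorm_conjTranspose]
  have hD : ‖Uᴴ * C * V‖ ≤ 1 := by
    refine (Matrix.l2_opNorm_mul _ _).trans (mul_le_one₀ ?_ (norm_nonneg _) hV1)
    refine (Matrix.l2_opNorm_mul _ _).trans (mul_le_one₀ hUH (norm_nonneg _) hC.le)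
  have hyu : ‖WithLp.toLp 2 y‖ ≤ ‖WithLp.toLp 2 u‖ := by
    rw [← hUu]
    exact (norm_toLp_mulVec_le U u).trans (mul_le_of_le_one_left (norm_nonneg _) hU1)
  have hvx : ‖WithLp.toLp 2 v‖ ≤ ‖WithLp.toLp 2 x‖ := by
    rw [← hVx]
    exact (norm_toLp_mulVec_le Vᴴ x).trans (mul_le_of_le_one_left (norm_nonneg _) hVH)
  calc ‖WithLp.toLp 2 y‖ ≤ ‖WithLp.toLp 2 u‖ := hyu
    _ ≤ ‖M ⊙ (Uᴴ * C * V)‖ * ‖WithLp.toLp 2 v‖ := hu ▸ norm_toLp_mulVec_le _ v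
    _ ≤ schurNorm M * ‖WithLp.toLp 2 x‖ := by
        refine mul_le_mul ?_ hvx (norm_nonneg _) (schurNorm_nonneg M)
        exact (norm_hadamard_le_schurNorm_mul M _).trans
          (mul_le_of_le_one_right (schurNorm_nonneg M) hD)

theorem schurNorm_submatrix_of_surjective [Nonempty κ] (M : Matrix ι ι ℂ) {f g : κ → ι}
    (hf : Function.Surjective f) (hg : Function.Surjective g) :
    schurNorm (M.submatrix f g) = schurNorm M := by
  have : Nonempty ι := ⟨f (Classical.arbitrary κ)⟩
  refine le_antisymm (schurNorm_submatrix_le M f g) ?_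
  -- Right inverses of `f` and `g` recover `M` as a submatrix of its own inflation.
  have h := schurNorm_submatrix_le (M.submatrix f g)
    (Function.surjInv hf) (Function.surjInv hg)
  rwa [Matrix.submatrix_submatrix, (Function.rightInverse_surjInv hf).id,
    (Function.rightInverse_surjInv hg).id, Matrix.submatrix_id_id] at h

theorem schurNorm_kronecker [Nonempty ι] [Nonempty κ] (M : Matrix ι ι ℂ) (N : Matrix κ κ ℂ) :
    schurNorm (M ⊗ₖ N) = schurNorm M * schurNorm N := by
  apply le_antisymm
  · have h : M ⊗ₖ N = (M.submatrix (Prod.fst : ι × κ → ι) Prod.fst) ⊙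
        (N.submatrix (Prod.snd : ι × κ → κ) Prod.snd) := rfl
    rw [h]
    exact (schurNorm_hadamard_le _ _).trans (mul_le_mul (schurNorm_submatrix_le M _ _)
      (schurNorm_submatrix_le N _ _) (schurNorm_nonneg _) (schurNorm_nonneg _))
  · obtain ⟨C, hC, hM⟩ := (schurNorm_isGreatest M).1
    obtain ⟨D, hD, hN⟩ := (schurNorm_isGreatest N).1
    rw [hM, hN, ← l2_opNorm_kronecker]
    refine (schurNorm_isGreatest (M ⊗ₖ N)).2
      ⟨C ⊗ₖ D, by rw [l2_opNorm_kronecker, hC, hD, one_mul], ?_⟩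
    congr 1
    ext ⟨i, k⟩ ⟨j, l⟩
    simp only [Matrix.hadamard_apply, Matrix.kroneckerMap_apply]
    ring

end SchurNorm

/-! ### Sign matrices and the Schur spectrum -/

theorem signMatrices_subset_boundedMatrices (n : ℕ) : signMatrices n ⊆ boundedMatrices n := by
  intro M hM i j
  rcases hM i j with h | h <;> simp [h]

theorem convexHull_signMatrices (n : ℕ) : convexHull ℝ (signMatrices n) = boundedMatrices n := by
  have hs : signMatrices n =
      Set.pi Set.univ fun _ => Set.pi Set.univ fun _ => ({-1, 1} : Set ℝ) := by
    ext M
    exact ⟨fun hM i _ j _ => hM i j, fun hM i j => hM i trivial j trivial⟩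
  have hb : boundedMatrices n =
      Set.pi Set.univ fun _ => Set.pi Set.univ fun _ => Set.Icc (-1 : ℝ) 1 := by
    ext M
    exact ⟨fun hM i _ j _ => abs_le.1 (hM i j), fun hM i j => abs_le.2 (hM i trivial j trivial)⟩
  rw [hs, hb]
  refine (convexHull_pi (𝕜 := ℝ) _ _).trans ?_
  congr 1; funext _
  rw [convexHull_pi]
  congr 1; funext _
  rw [convexHull_pair, segment_eq_Icc (by norm_num)]

theorem convexOn_norm_hadamard {ι : Type*} [Fintype ι] [DecidableEq ι] (C : Matrix ι ι ℂ) :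
    ConvexOn ℝ Set.univ
      fun M : Matrix ι ι ℝ => ‖(M.map (fun x : ℝ => (x : ℂ))) ⊙ C‖ := by
  refine ⟨convex_univ, fun M _ N _ a b ha hb _ => ?_⟩
  have h : ((a • M + b • N).map (fun x : ℝ => (x : ℂ))) ⊙ C =
      (a : ℂ) • (M.map (fun x : ℝ => (x : ℂ)) ⊙ C) +
        (b : ℂ) • (N.map (fun x : ℝ => (x : ℂ)) ⊙ C) := by
    ext i j
    simp
    ring
  simp only [h, smul_eq_mul]
  refine (norm_add_le _ _).trans_eq ?_
  rw [norm_smul, norm_smul, Complex.norm_real, Complex.norm_real, Real.norm_of_nonneg ha,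
    Real.norm_of_nonneg hb]

theorem isGreatest_schurSpectrum (n : ℕ) (hn : 1 ≤ n) :
    IsGreatest (schurSpectrum n) (maxSchurNorm n) := by
  have : Nonempty (Fin n) := ⟨⟨0, hn⟩⟩
  have hupper : maxSchurNorm n ∈ upperBounds (schurSpectrum n) := by
    rintro x ⟨M, hM, rfl⟩
    exact (maxSchurNorm_isGreatest n hn).2 ⟨M, signMatrices_subset_boundedMatrices n hM, rfl⟩
  refine ⟨?_, hupper⟩
  obtain ⟨M, hM, hMr⟩ := (maxSchurNorm_isGreatest n hn).1
  obtain ⟨C, hC, hMC⟩ := (schurNorm_isGreatest (M.map (fun x : ℝ => (x : ℂ)))).1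
  rw [← convexHull_signMatrices] at hM
  -- With the optimal `C` for `M` frozen, convexity of a single norm suffices.
  obtain ⟨N, hN, hle⟩ :=
    (convexOn_norm_hadamard C).exists_ge_of_mem_convexHull (Set.subset_univ _) hM
  refine ⟨N, hN, le_antisymm ?_ (hupper ⟨N, hN, rfl⟩)⟩
  rw [hMr, realSchurNorm, hMC]
  exact hle.trans ((schurNorm_isGreatest (N.map (fun x : ℝ => (x : ℂ)))).2 ⟨C, hC, rfl⟩)

theorem schurSpectrum_subset_of_surjective {n m : ℕ} (hm : 1 ≤ m) {f : Fin m → Fin n}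
    (hf : Function.Surjective f) : schurSpectrum n ⊆ schurSpectrum m := by
  have : Nonempty (Fin m) := ⟨⟨0, hm⟩⟩
  rintro x ⟨M, hM, rfl⟩
  exact ⟨M.submatrix f f, fun i j => hM (f i) (f j),
    (schurNorm_submatrix_of_surjective (M.map (fun x : ℝ => (x : ℂ))) hf hf).symm⟩

theorem schurSpectrum_mul_subset {n m : ℕ} (hn : 1 ≤ n) (hm : 1 ≤ m) :
    schurSpectrum n * schurSpectrum m ⊆ schurSpectrum (n * m) := by
  have : Nonempty (Fin n) := ⟨⟨0, hn⟩⟩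
  have : Nonempty (Fin m) := ⟨⟨0, hm⟩⟩
  have : Nonempty (Fin (n * m)) := ⟨⟨0, Nat.mul_pos hn hm⟩⟩
  rintro _ ⟨_, ⟨M, hM, rfl⟩, _, ⟨N, hN, rfl⟩, rfl⟩
  have e : Function.Surjective (finProdFinEquiv (m := n) (n := m)).symm := Equiv.surjective _
  refine ⟨(M ⊗ₖ N).submatrix finProdFinEquiv.symm finProdFinEquiv.symm, fun i j => ?_, ?_⟩
  · simp only [Matrix.submatrix_apply, Matrix.kroneckerMap_apply]
    rcases hM (finProdFinEquiv.symm i).1 (finProdFinEquiv.symm j).1 with h | h <;>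
    rcases hN (finProdFinEquiv.symm i).2 (finProdFinEquiv.symm j).2 with h' | h' <;>
    rw [h, h'] <;> norm_num
  · have h : ((M ⊗ₖ N).submatrix finProdFinEquiv.symm finProdFinEquiv.symm).map
        (fun x : ℝ => (x : ℂ)) =
        ((M.map (fun x : ℝ => (x : ℂ))) ⊗ₖ (N.map (fun x : ℝ => (x : ℂ)))).submatrix
          finProdFinEquiv.symm finProdFinEquiv.symm := by
      ext i j
      simp
    simp only [realSchurNorm]
    rw [h, schurNorm_submatrix_of_surjective _ e e, schurNorm_kronecker]

theorem theorem3 :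
    (∀ n : ℕ, 1 ≤ n → IsGreatest (schurSpectrum n) (maxSchurNorm n)) ∧
    (∀ n : ℕ, 1 ≤ n → schurSpectrum n ⊆ schurSpectrum (n + 1)) ∧
    (∀ n m : ℕ, 1 ≤ n → 1 ≤ m →
      schurSpectrum n * schurSpectrum m ⊆ schurSpectrum (n * m)) := by
  refine ⟨isGreatest_schurSpectrum, fun n hn => ?_, fun n m hn hm => schurSpectrum_mul_subset hn hm⟩
  have : NeZero n := ⟨by omega⟩
  -- Reduction mod `n` sends the extra index `n` to `0`, so the first row and column are repeated.
  exact schurSpectrum_subset_of_surjective (by omega) (f := fun i => Fin.ofNat n i)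
    fun j => ⟨j.castSucc, by ext; simp⟩
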